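/- **Setting.** For a rational matrix $X(s)$ put $X(s)^H=X(-s^*)^\dagger$. A completely passive quantum channel with input fields $u$ (dimension $n$), $w$ (dimension $n_w$), output fields $y$ (dimension $n_y$), $d$ (dimension $n_d$), $n_y+n_d=n+n_w$, has transfer function $G(s)=D+C(sI-A)^{-1}B$, where $(A,B,C,D)$ is a minimal realization with complex entries, $A+A^\dagger+BB^\dagger=0$, $B=-C^\dagger D$, $D^\dagger D=DD^\dagger=I$. Let $G_{11}$, $G_{12}$ be the blocks of $G$ from $u$, $w$ to $y$. Let $\Sigma_u,\Sigma_w$ be Hermitian positive definite matrices, the intensities of the uncorrelated zero mean thermal fields $u,w$; i.e. the annihilation parts of $u$, $w$ are white with spectra $I+\Sigma_u^T$, $I+\Sigma_w^T$. An admissible equalizer is a square stable rational transfer function $H(s)\in H_\infty$ from $\mathrm{col}(y,z)$ to $\mathrm{col}(\hat u,\hat z)$, where $\hat u$ has dimension $n$ and the vacuum environment $z$ (uncorrelated with $u$, $w$, of spectrum $I$) has any finite dimension, such that $H$ is analytic in $\mathrm{Re}\,s>-\tau$ for some $\tau>0$ and $H^HH=HH^H=I$. The set of these is $\mathcal H_p$;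 $H_{11}$, $H_{12}$ are the blocks of $H$ from $y$, $z$ to $\hat u$. $P_e$ denotes the power spectrum density of the error $e=\hat u-u$, i.e. $P_e=T\,\mathrm{diag}(I+\Sigma_u^T,\,I+\Sigma_w^T,\,I)\,T^H$ with $T=[\,H_{11}G_{11}-I,\ H_{11}G_{12},\ H_{12}\,]$. The optimal performance $\gamma_\circ$ is the infimum of the $\gamma>0$ for which some $H\in\mathcal H_p$ satisfies $P_e(i\omega)<\gamma^2I$ for all real $\omega$. For an $n\times n_y$ rational matrix $H_{11}$ let $$P[H_{11}]=\begin{bmatrix}H_{11}&I\end{bmatrix}\begin{bmatrix}G_{11}\Sigma_u^TG_{11}^H+G_{12}\Sigma_w^TG_{12}^H&-G_{11}(I+\Sigma_u^T)\\-(I+\Sigma_u^T)G_{11}^H&\Sigma_u^T+2I\end{bmatrix}\begin{bmatrix}H_{11}^H\\I\end{bmatrix},$$ the expression of $P_e$ through the block $H_{11}$ alone. Consider the conditions (H1) all poles of $H_{11}$ lie in the open left half-plane, and $H_{11}$ is analytic in $\mathrm{Re}\,s>-\tau$ for some $\tau>0$; (H2) $H_{11}(i\omega)H_{11}(i\omega)^\dagger\le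 I$ for all real $\omega$; (H3) the normal ranks of $I-H_{11}H_{11}^H$ and of $I-H_{11}^HH_{11}$ do not change on the finite imaginary axis. For $\gamma>0$ let $\mathcal H^-_{11,\gamma}$ be the set of proper rational $n\times n_y$ matrices $H_{11}$ that satisfy (H1), $P[H_{11}](i\omega)<\gamma^2I$ for all real $\omega$, and $H_{11}(i\omega)H_{11}(i\omega)^\dagger<I$ for all $\omega\in\mathbf R\cup\{\pm\infty\}$. Let $\gamma_\circ''=\inf\{\gamma>0:\mathcal H^-_{11,\gamma}\ne\emptyset\}$. **Theorem 1.** Let $\gamma>0$ be such that $\mathcal H^-_{11,\gamma}\neq\emptyset$. Then every $H_{11}\in\mathcal H^-_{11,\gamma}$ satisfies (H1), (H2) and (H3), and there is an admissible equalizer $H\in\mathcal H_p$ with $(1,1)$ block $H_{11}$ whose error satisfies $P_e(i\omega)<\gamma^2I$ for all real $\omega$. The infimum of the $\beta>0$ for which $P_e(i\omega)<\beta^2I$ for all real $\omega$ holds for some $H\in\mathcal H_p$ whose $(1,1)$ block belongs to $\mathcal H^-_{11,\delta}$ for some $\delta>0$ is equal to $\gamma_\circ''$. Consequently $\gamma_\circ''\ge\gamma_\circ$.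 -/

import Mathlib

open Polynomial Filter Topology Matrix
open scoped ComplexOrder

noncomputable section

namespace CoherentEq

/-- Matrices of rational functions of the complex variable `s`. -/
abbrev RatMat (p q : Type*) := Matrix p q (RatFunc ℂ)

section Rational

/-- The ring endomorphism `p(s) ↦ conj (p(-conj s))` of `ℂ[s]`. -/
def polyParaConj : ℂ[X] →+* ℂ[X] :=
  (Polynomial.compRingHom (-X)).comp (Polynomial.mapRingHom (starRingEnd ℂ))

theorem polyParaConj_injective : Function.Injective polyParaConj := by
  intro p q h
  have h' : (p.map (starRingEnd ℂ)).comp (-X) = (q.map (starRingEnd ℂ)).comp (-X) := h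
  have h2 := congrArg (fun r : ℂ[X] => r.comp (-X)) h'
  simp only [Polynomial.comp_assoc, Polynomial.neg_comp, Polynomial.X_comp, neg_neg,
    Polynomial.comp_X] at h2
  exact Polynomial.map_injective _ (starRingEnd ℂ).injective h2

theorem polyParaConj_nonZeroDivisors :
    nonZeroDivisors ℂ[X] ≤ (nonZeroDivisors ℂ[X]).comap polyParaConj :=
  nonZeroDivisors_le_comap_nonZeroDivisors_of_injective _ polyParaConj_injective

/-- The rational function `f(s) ↦ conj (f(-conj s))`. -/
def ratParaConj : RatFunc ℂ →+* RatFunc ℂ :=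
  RatFunc.mapRingHom polyParaConj polyParaConj_nonZeroDivisors

variable {p q : Type*}

/-- The para-Hermitian conjugate `X(s)^H = X(-s^*)^†`. -/
def paraConj (X : RatMat p q) : RatMat q p := (X.map ratParaConj)ᵀ

/-- The constant rational matrix. -/
def const (M : Matrix p q ℂ) : RatMat p q := M.map RatFunc.C

/-- The value `X(s)` at a point `s` (meaningful where no entry has a pole). -/
def valAt (X : RatMat p q) (s : ℂ) : Matrix p q ℂ :=
  X.map (RatFunc.eval (RingHom.id ℂ) s)

/-- The value `X(iω)`. -/
def onAxis (X : RatMat p q) (ω : ℝ) : Matrix p q ℂ := valAt X (Complex.I * (ω : ℂ))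

/-- `s` is a pole of the rational matrix `X`. Fractions are in lowest terms. -/
def IsPole (X : RatMat p q) (s : ℂ) : Prop := ∃ i j, (X i j).denom.IsRoot s

/-- Proper: every entry has numerator degree at most the denominator degree. -/
def IsProper (X : RatMat p q) : Prop := ∀ i j, (X i j).num.degree ≤ (X i j).denom.degree

/-- `r` is the normal rank of `X`: some minor of order `r` does not vanish identically, and all
minors of larger order vanish identically. -/
def IsNormalRank (X : RatMat p q) (r : ℕ) : Prop :=
  (∃ (f : Fin r ↪ p) (g : Fin r ↪ q), (X.submatrix f g).det ≠ 0) ∧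
    ∀ k, r < k → ∀ (f : Fin k ↪ p) (g : Fin k ↪ q), (X.submatrix f g).det = 0

/-- The normal rank of `X` does not change on the finite imaginary axis. -/
def ConstNormalRankOnAxis [Fintype q] (X : RatMat p q) : Prop :=
  ∃ r, IsNormalRank X r ∧ ∀ ω : ℝ, (onAxis X ω).rank = r

/-- All poles lie in the open left half-plane, and `X` is analytic in `Re s > -τ` for some
`τ > 0`. -/
def CondH1 (X : RatMat p q) : Prop :=
  (∀ s, IsPole X s → s.re < 0) ∧
    ∃ τ : ℝ, 0 < τ ∧ ∀ i j, AnalyticOnNhd ℂ (fun s => valAt X s i j) {s | -τ < s.re}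

/-- `X(iω) X(iω)^† ≤ I` for all real `ω`. -/
def CondH2 [Fintype q] [DecidableEq p] (X : RatMat p q) : Prop :=
  ∀ ω : ℝ, (1 - onAxis X ω * (onAxis X ω)ᴴ).PosSemidef

/-- The normal ranks of `I - X X^H` and of `I - X^H X` do not change on the imaginary axis. -/
def CondH3 [Fintype p] [Fintype q] [DecidableEq p] [DecidableEq q] (X : RatMat p q) : Prop :=
  ConstNormalRankOnAxis (1 - X * paraConj X) ∧ ConstNormalRankOnAxis (1 - paraConj X * X)

/-- `X(iω) X(iω)^† < I` on the closed axis `ℝ ∪ {±∞}`; the value at `±∞` is the limit. -/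
def StrictlyContractive [Fintype q] [DecidableEq p] (X : RatMat p q) : Prop :=
  (∀ ω : ℝ, (1 - onAxis X ω * (onAxis X ω)ᴴ).PosDef) ∧
    ∃ J : Matrix p q ℂ, Tendsto (onAxis X) (atBot ⊔ atTop) (𝓝 J) ∧ (1 - J * Jᴴ).PosDef

/-- Transfer function `D + C (sI - A)⁻¹ B`. -/
def transferFunction {k : ℕ} [Fintype q] (A : Matrix (Fin k) (Fin k) ℂ) (B : Matrix (Fin k) q ℂ)
    (C : Matrix p (Fin k) ℂ) (D : Matrix p q ℂ) : RatMat p q :=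
  const D + const C * ((RatFunc.X : RatFunc ℂ) • (1 : RatMat (Fin k) (Fin k)) - const A)⁻¹ * const B

end Rational

/-- A completely passive quantum channel with inputs `u` (dimension `n`), `w` (dimension `nw`),
outputs `y` (dimension `ny`), `d` (dimension `nd`) and `m` oscillator modes, together with the
intensities of the thermal fields `u`, `w`. -/
structure Channel (n nw ny nd m : ℕ) where
  A : Matrix (Fin m) (Fin m) ℂ
  B : Matrix (Fin m) (Fin n ⊕ Fin nw) ℂ
  C : Matrix (Fin ny ⊕ Fin nd) (Fin m) ℂ
  D : Matrix (Fin ny ⊕ Fin nd) (Fin n ⊕ Fin nw) ℂ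
  sigmaU : Matrix (Fin n) (Fin n) ℂ
  sigmaW : Matrix (Fin nw) (Fin nw) ℂ
  dim_eq : ny + nd = n + nw
  sigmaU_pos : sigmaU.PosDef
  sigmaW_pos : sigmaW.PosDef
  /-- Physical realizability. -/
  lyapunov : A + Aᴴ + B * Bᴴ = 0
  coupling : B = -(Cᴴ * D)
  unitary_left : Dᴴ * D = 1
  unitary_right : D * Dᴴ = 1
  /-- `(A, B, C, D)` is a realization of least state dimension of its transfer function. -/
  minimal : ∀ (k : ℕ) (A' : Matrix (Fin k) (Fin k) ℂ) (B' : Matrix (Fin k) (Fin n ⊕ Fin nw) ℂ)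
    (C' : Matrix (Fin ny ⊕ Fin nd) (Fin k) ℂ) (D' : Matrix (Fin ny ⊕ Fin nd) (Fin n ⊕ Fin nw) ℂ),
    transferFunction A' B' C' D' = transferFunction A B C D → m ≤ k

/-- The admissible completely passive physically realizable equalizers with `nz` environment
inputs: square stable rational transfer functions `col(y, z) ↦ col(û, ẑ)` in `H_∞`, analytic in
`Re s > -τ` for some `τ > 0`, and paraunitary. -/
structure Admissible {n ny nz nzh : ℕ} (H : RatMat (Fin n ⊕ Fin nzh) (Fin ny ⊕ Fin nz)) :
    Prop where
  square : n + nzh = ny + nz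
  stable : CondH1 H
  bounded : ∃ M : ℝ, ∀ s : ℂ, 0 < s.re → ∀ i j, ‖valAt H s i j‖ ≤ M
  paraunitary_left : paraConj H * H = 1
  paraunitary_right : H * paraConj H = 1

namespace Channel

variable {n nw ny nd m : ℕ} (S : Channel n nw ny nd m)

/-- The channel transfer function. -/
def G : RatMat (Fin ny ⊕ Fin nd) (Fin n ⊕ Fin nw) := transferFunction S.A S.B S.C S.D

def G11 : RatMat (Fin ny) (Fin n) := S.G.toBlocks₁₁

def G12 : RatMat (Fin ny) (Fin nw) := S.G.toBlocks₁₂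

/-- `Ψ = G₁₁ Σᵤᵀ G₁₁^H + G₁₂ Σ_wᵀ G₁₂^H`. -/
def Psi : RatMat (Fin ny) (Fin ny) :=
  S.G11 * const S.sigmaUᵀ * paraConj S.G11 + S.G12 * const S.sigmaWᵀ * paraConj S.G12

def Phi : RatMat (Fin ny ⊕ Fin n) (Fin ny ⊕ Fin n) :=
  fromBlocks S.Psi (-(S.G11 * const (1 + S.sigmaUᵀ)))
    (-(const (1 + S.sigmaUᵀ) * paraConj S.G11)) (const (S.sigmaUᵀ + (2 : ℂ) • 1))

/-- The function `[H₁₁ I] Φ [H₁₁^H; I]`, which expresses the error spectrum through the block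
`H₁₁` alone. -/
def psdOfBlock (H11 : RatMat (Fin n) (Fin ny)) : RatMat (Fin n) (Fin n) :=
  fromCols H11 (1 : RatMat (Fin n) (Fin n)) * S.Phi *
    fromRows (paraConj H11) (1 : RatMat (Fin n) (Fin n))

/-- The transfer function `[H₁₁G₁₁ - I, H₁₁G₁₂, H₁₂]` from `col(u, w, z)` to the equalization
error `e = û - u`, where `û = H₁₁ y + H₁₂ z` and `y = G₁₁ u + G₁₂ w`. -/
def errorTransfer {nz nzh : ℕ} (H : RatMat (Fin n ⊕ Fin nzh) (Fin ny ⊕ Fin nz)) :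
    RatMat (Fin n) ((Fin n ⊕ Fin nw) ⊕ Fin nz) :=
  fromCols (fromCols (H.toBlocks₁₁ * S.G11 - 1) (H.toBlocks₁₁ * S.G12)) H.toBlocks₁₂

/-- The (constant) spectrum of the annihilation part of the input `col(u, w, z)`: thermal `u`, `w`
and vacuum `z`, mutually uncorrelated. -/
def inputSpectrum (nz : ℕ) :
    Matrix ((Fin n ⊕ Fin nw) ⊕ Fin nz) ((Fin n ⊕ Fin nw) ⊕ Fin nz) ℂ :=
  fromBlocks (fromBlocks (1 + S.sigmaUᵀ) 0 0 (1 + S.sigmaWᵀ)) 0 0 1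

/-- The power spectrum density `P_e(s)` of the equalization error of the channel-filter system,
i.e. the bilateral Laplace transform of `⟨e(t) e(0)^†⟩`. -/
def errorPSD {nz nzh : ℕ} (H : RatMat (Fin n ⊕ Fin nzh) (Fin ny ⊕ Fin nz)) :
    RatMat (Fin n) (Fin n) :=
  S.errorTransfer H * const (S.inputSpectrum nz) * paraConj (S.errorTransfer H)

end Channel

/-- `P(iω) < γ² I` for all real `ω`. -/
def BoundedOnAxis {n : ℕ} (P : RatMat (Fin n) (Fin n)) (γ : ℝ) : Prop :=
  ∀ ω : ℝ, (((γ : ℂ) ^ 2) • (1 : Matrix (Fin n) (Fin n) ℂ) - onAxis P ω).PosDef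

namespace Channel

variable {n nw ny nd m : ℕ} (S : Channel n nw ny nd m)

/-- The feasible set of the contractive relaxation at level `γ`. -/
def contractiveSet (γ : ℝ) : Set (RatMat (Fin n) (Fin ny)) :=
  {H11 | IsProper H11 ∧ CondH1 H11 ∧ BoundedOnAxis (S.psdOfBlock H11) γ ∧ StrictlyContractive H11}

/-- The optimal equalization performance `γ∘`; the number of environment fields of the equalizer
is a design parameter. -/
def gammaOpt : ℝ :=
  sInf {γ | 0 < γ ∧ ∃ (nz nzh : ℕ) (H : RatMat (Fin n ⊕ Fin nzh) (Fin ny ⊕ Fin nz)),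
    Admissible H ∧ BoundedOnAxis (S.errorPSD H) γ}

/-- The value `γ∘''` of the contractive relaxation. -/
def gammaContractive : ℝ := sInf {γ | 0 < γ ∧ (S.contractiveSet γ).Nonempty}

/-- The infimal performance over those admissible equalizers whose (1,1) block is an element of
one of the sets `contractiveSet γ'`, `γ' > 0`. -/
def gammaConstructed : ℝ :=
  sInf {γ | 0 < γ ∧ ∃ (nz nzh : ℕ) (H : RatMat (Fin n ⊕ Fin nzh) (Fin ny ⊕ Fin nz)),
    Admissible H ∧ (∃ γ' : ℝ, 0 < γ' ∧ H.toBlocks₁₁ ∈ S.contractiveSet γ') ∧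
      BoundedOnAxis (S.errorPSD H) γ}

end Channel

end CoherentEq

end

/-!
The error spectrum of an admissible equalizer depends on its block `H₁₁` only. As the channel is
lossless, `G₁₁ G₁₁^H + G₁₂ G₁₂^H = I`; as the equalizer is paraunitary, its vacuum noise contributes
`H₁₂ H₁₂^H = I - H₁₁ H₁₁^H`. Expanding `P_e` with these identities gives `P[H₁₁]`
(`Channel.errorPSD_eq_psdOfBlock`). Hence everything reduces to the lossless extension problem: every
stable `H₁₁` that is strictly contractive on the imaginary axis is the (1,1) block of an admissible
equalizer (`exists_admissible_extension`). The claims on the infima are then inclusions or equalities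
of the sets of performance levels.

Since the number of environment fields is free, the extension needs neither minimality nor a
canonical (minimum phase) spectral factor, and it is obtained by algebra over the field `ℂ(s)` with
its involution `f ↦ f^H`:

* A rational function that is nonnegative on the imaginary axis has the form `g g^H`
  (`exists_spectral_factor`). So the Hermitian form of `W = I - H₁₁ H₁₁^H` represents only elements
  `g g^H`, and the Cholesky algorithm factorizes `W = M M^H` (`exists_factor_of_posDef`).
* Multiplication by a scalar all-pass function `b` with `b b^H = 1` moves all poles of a rational
  matrix out of the open right half-plane (`exists_stabilizing_allpass`). With such a `b`, the row
  `R = [H₁₁, b M]` satisfies `R R^H = I`.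
* The Halmos dilation of a co-isometry `R` is the square paraunitary matrix
  `[R, 0; I - R^H R, -R^H]`. Its first block row is stable already, and its second block row may be
  multiplied by another all-pass function (`dilation`).
* A paraunitary matrix is bounded by one on the imaginary axis; hence it has no poles there, it is
  proper, and it is in `H_∞` when it has no poles in the open right half-plane
  (`admissible_of_paraunitary`).

The rank conditions hold since `I - X X^†` and `I - X^† X` have the same determinant, which is nonzero
on the whole axis (`condH3_of_posDef`).
-/

noncomputable section

namespace CoherentEq

/-! ### Evaluation of rational functions at regular points -/

/-- The rational function `f` has no pole at `s`. -/
def RegularAt (s : ℂ) (f : RatFunc ℂ) : Prop := f.denom.eval s ≠ 0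

/-- The value of a rational function at `s`; it is `0` at a pole. -/
abbrev value (s : ℂ) (f : RatFunc ℂ) : ℂ := RatFunc.eval (RingHom.id ℂ) s f

theorem value_eq (s : ℂ) (f : RatFunc ℂ) : value s f = f.num.eval s / f.denom.eval s := rfl

theorem RegularAt.of_eq_div {s : ℂ} {f : RatFunc ℂ} {p q : ℂ[X]} (hq : q.eval s ≠ 0)
    (h : f = algebraMap _ _ p / algebraMap _ _ q) : RegularAt s f := by
  intro h0
  have hd : f.denom ∣ q := by
    rw [h]
    exact RatFunc.denom_div_dvd p q
  exact hq (Polynomial.eval_eq_zero_of_dvd_of_eval_eq_zero hd h0)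

theorem value_of_eq_div {s : ℂ} {f : RatFunc ℂ} {p q : ℂ[X]} (hq : q.eval s ≠ 0)
    (h : f = algebraMap _ _ p / algebraMap _ _ q) : value s f = p.eval s / q.eval s := by
  have hf : RegularAt s f := .of_eq_div hq h
  have hq0 : q ≠ 0 := by
    rintro rfl
    simp at hq
  have key : f.num * q = p * f.denom := by
    rw [RatFunc.num_mul_eq_mul_denom_iff hq0]
    exact h
  rw [value_eq, div_eq_div_iff hf hq, ← Polynomial.eval_mul, key, Polynomial.eval_mul]

section Pointwise

variable {s : ℂ} {f g : RatFunc ℂ}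

theorem RegularAt.add (hf : RegularAt s f) (hg : RegularAt s g) : RegularAt s (f + g) := fun h =>
  (mul_ne_zero hf hg) (by
    rw [← Polynomial.eval_mul]
    exact Polynomial.eval_eq_zero_of_dvd_of_eval_eq_zero (RatFunc.denom_add_dvd f g) h)

theorem RegularAt.mul (hf : RegularAt s f) (hg : RegularAt s g) : RegularAt s (f * g) := fun h =>
  (mul_ne_zero hf hg) (by
    rw [← Polynomial.eval_mul]
    exact Polynomial.eval_eq_zero_of_dvd_of_eval_eq_zero (RatFunc.denom_mul_dvd f g) h)

theorem regularAt_C (c : ℂ) : RegularAt s (RatFunc.C c) := by simp [RegularAt]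

theorem regularAt_zero : RegularAt s 0 := by simp [RegularAt]

theorem regularAt_one : RegularAt s 1 := by simp [RegularAt]

theorem RegularAt.neg (hf : RegularAt s f) : RegularAt s (-f) := by
  have h := (regularAt_C (s := s) (-1)).mul hf
  rwa [map_neg, map_one, neg_one_mul] at h

theorem RegularAt.sub (hf : RegularAt s f) (hg : RegularAt s g) : RegularAt s (f - g) := by
  rw [sub_eq_add_neg]
  exact hf.add hg.neg

theorem value_add (hf : RegularAt s f) (hg : RegularAt s g) :
    value s (f + g) = value s f + value s g := RatFunc.eval_add _ _ hf hg

theorem value_mul (hf : RegularAt s f) (hg : RegularAt s g) :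
    value s (f * g) = value s f * value s g := RatFunc.eval_mul _ _ hf hg

theorem value_neg (hf : RegularAt s f) : value s (-f) = -value s f := by
  have h := value_mul (regularAt_C (s := s) (-1)) hf
  rw [map_neg, map_one, neg_one_mul] at h
  rw [h, value, ← map_one RatFunc.C, ← map_neg, RatFunc.eval_C]
  simp

theorem value_sub (hf : RegularAt s f) (hg : RegularAt s g) :
    value s (f - g) = value s f - value s g := by
  rw [sub_eq_add_neg, value_add hf hg.neg, value_neg hg, sub_eq_add_neg]

theorem RegularAt.sum {ι : Type*} (t : Finset ι) {F : ι → RatFunc ℂ}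
    (h : ∀ i, RegularAt s (F i)) : RegularAt s (∑ i ∈ t, F i) := by
  classical
  induction t using Finset.induction_on with
  | empty => simpa using regularAt_zero
  | insert a t ha ih =>
    rw [Finset.sum_insert ha]
    exact (h a).add ih

theorem value_sum {ι : Type*} (t : Finset ι) {F : ι → RatFunc ℂ}
    (h : ∀ i, RegularAt s (F i)) : value s (∑ i ∈ t, F i) = ∑ i ∈ t, value s (F i) := by
  classical
  induction t using Finset.induction_on with
  | empty => simp [value]
  | insert a t ha ih =>
    rw [Finset.sum_insert ha, Finset.sum_insert ha, value_add (h a) (.sum t h), ih]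

end Pointwise

/-! ### Para-conjugation -/

theorem eval_polyParaConj (p : ℂ[X]) (s : ℂ) :
    (polyParaConj p).eval s = star (p.eval (-star s)) := by
  change ((p.map (starRingEnd ℂ)).comp (-X)).eval s = starRingEnd ℂ (p.eval (-star s))
  rw [Polynomial.eval_comp, Polynomial.eval_map, ← Polynomial.eval₂_at_apply]
  simp

theorem neg_star_I_mul (ω : ℝ) : -star (Complex.I * (ω : ℂ)) = Complex.I * ω := by
  simp

theorem eval_polyParaConj_axis (p : ℂ[X]) (ω : ℝ) :
    (polyParaConj p).eval (Complex.I * ω) = star (p.eval (Complex.I * ω)) := by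
  rw [eval_polyParaConj, neg_star_I_mul]

theorem polyParaConj_C (c : ℂ) : polyParaConj (C c) = C (star c) := by
  simp [polyParaConj]

theorem polyParaConj_X : polyParaConj X = -X := by simp [polyParaConj]

theorem polyParaConj_polyParaConj (p : ℂ[X]) : polyParaConj (polyParaConj p) = p := by
  refine Polynomial.funext fun s => ?_
  simp [eval_polyParaConj]

theorem polyParaConj_ne_zero {p : ℂ[X]} (hp : p ≠ 0) : polyParaConj p ≠ 0 := by
  rw [Ne, ← map_zero polyParaConj]
  exact fun h => hp (polyParaConj_injective h)

theorem ratParaConj_div (p q : ℂ[X]) :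
    ratParaConj (algebraMap _ _ p / algebraMap _ _ q) =
      algebraMap _ _ (polyParaConj p) / algebraMap _ _ (polyParaConj q) :=
  RatFunc.map_apply_div polyParaConj polyParaConj_nonZeroDivisors p q

theorem ratParaConj_algebraMap (p : ℂ[X]) :
    ratParaConj (algebraMap _ _ p) = algebraMap _ _ (polyParaConj p) := by
  simpa using ratParaConj_div p 1

theorem ratParaConj_C (c : ℂ) : ratParaConj (RatFunc.C c) = RatFunc.C (star c) := by
  rw [← RatFunc.algebraMap_C, ratParaConj_algebraMap, polyParaConj_C, RatFunc.algebraMap_C]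

theorem ratParaConj_X : ratParaConj RatFunc.X = -RatFunc.X := by
  rw [← RatFunc.algebraMap_X, ratParaConj_algebraMap, polyParaConj_X, map_neg]

theorem ratParaConj_ratParaConj (f : RatFunc ℂ) : ratParaConj (ratParaConj f) = f := by
  rw [← RatFunc.num_div_denom f, ratParaConj_div, ratParaConj_div, polyParaConj_polyParaConj,
    polyParaConj_polyParaConj]

theorem ratParaConj_eq_div (f : RatFunc ℂ) : ratParaConj f =
    algebraMap _ _ (polyParaConj f.num) / algebraMap _ _ (polyParaConj f.denom) := by
  conv_lhs => rw [← RatFunc.num_div_denom f, ratParaConj_div]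

theorem RegularAt.ratParaConj {ω : ℝ} {f : RatFunc ℂ} (hf : RegularAt (Complex.I * ω) f) :
    RegularAt (Complex.I * ω) (ratParaConj f) :=
  .of_eq_div (by rw [eval_polyParaConj_axis]; exact star_ne_zero.2 hf) (ratParaConj_eq_div f)

theorem value_ratParaConj {ω : ℝ} {f : RatFunc ℂ} (hf : RegularAt (Complex.I * ω) f) :
    value (Complex.I * ω) (ratParaConj f) = star (value (Complex.I * ω) f) := by
  rw [value_of_eq_div (by rw [eval_polyParaConj_axis]; exact star_ne_zero.2 hf)
    (ratParaConj_eq_div f), eval_polyParaConj_axis, eval_polyParaConj_axis, value_eq, star_div₀]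

/-- A nonzero polynomial vanishes at finitely many points of the imaginary axis only. -/
theorem eventually_eval_axis_ne_zero {p : ℂ[X]} (hp : p ≠ 0) :
    ∀ᶠ ω : ℝ in cofinite, p.eval (Complex.I * ω) ≠ 0 := by
  have hinj : Function.Injective fun ω : ℝ => Complex.I * (ω : ℂ) := fun a b h => by
    simpa using h
  have h : ∀ᶠ z in cofinite, p.eval z ≠ 0 :=
    (Polynomial.finite_setOfPred_isRoot hp).compl_mem_cofinite
  exact hinj.tendsto_cofinite.eventually h

theorem eventually_regularAt (f : RatFunc ℂ) :
    ∀ᶠ ω : ℝ in cofinite, RegularAt (Complex.I * ω) f :=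
  eventually_eval_axis_ne_zero f.denom_ne_zero

theorem eventually_value_ne_zero {f : RatFunc ℂ} (hf : f ≠ 0) :
    ∀ᶠ ω : ℝ in cofinite, value (Complex.I * ω) f ≠ 0 := by
  filter_upwards [eventually_regularAt f,
    eventually_eval_axis_ne_zero (RatFunc.num_ne_zero hf)] with ω h1 h2
  exact div_ne_zero h2 h1

/-! ### Scalar spectral factorization -/

theorem nonneg_of_ofReal_mul_nonneg {r : ℝ} (hr : 0 < r) {z : ℂ} (h : 0 ≤ (r : ℂ) * z) :
    0 ≤ z := by
  rw [Complex.nonneg_iff] at h ⊢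
  rw [Complex.re_ofReal_mul, Complex.im_ofReal_mul] at h
  exact ⟨nonneg_of_mul_nonneg_right h.1 hr,
    ((mul_eq_zero.1 h.2.symm).resolve_left hr.ne').symm⟩

theorem continuous_eval_axis (p : ℂ[X]) :
    Continuous fun ω : ℝ => p.eval (Complex.I * (ω : ℂ)) := by
  have := p.continuous
  fun_prop

theorem eval_axis_nonneg_of_eventually {p : ℂ[X]}
    (h : ∀ᶠ ω : ℝ in cofinite, 0 ≤ p.eval (Complex.I * ω)) (ω : ℝ) :
    0 ≤ p.eval (Complex.I * ω) := by
  have hcl : IsClosed {ω : ℝ | 0 ≤ p.eval (Complex.I * (ω : ℂ))} :=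
    isClosed_le continuous_const (continuous_eval_axis p)
  have hd : Dense {ω : ℝ | 0 ≤ p.eval (Complex.I * (ω : ℂ))} := by
    have := (Filter.mem_cofinite.1 h).countable.dense_compl ℝ
    rwa [compl_compl] at this
  have := hd ω
  rwa [hcl.closure_eq] at this

theorem polyParaConj_eq_self {p : ℂ[X]} (h : ∀ ω : ℝ, 0 ≤ p.eval (Complex.I * (ω : ℂ))) :
    polyParaConj p = p := by
  by_contra hne
  obtain ⟨ω, hω⟩ := (eventually_eval_axis_ne_zero (sub_ne_zero.2 hne)).exists
  rw [Polynomial.eval_sub, eval_polyParaConj_axis, (IsSelfAdjoint.of_nonneg (h ω)).star_eq,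
    sub_self] at hω
  exact hω rfl

/-- An imaginary root of a polynomial that is nonnegative on the imaginary axis is a multiple
root, as the polynomial does not change its sign there. -/
theorem eval_quotient_eq_zero {p r : ℂ[X]} {a : ℝ}
    (h : ∀ ω : ℝ, 0 ≤ p.eval (Complex.I * (ω : ℂ))) (hp : p = (X - C (Complex.I * (a : ℂ))) * r) :
    r.eval (Complex.I * a) = 0 := by
  have hv : ∀ ω : ℝ, 0 ≤ ((ω - a : ℝ) : ℂ) * (Complex.I * r.eval (Complex.I * ω)) := fun ω => by
    have := h ω
    rw [hp] at this
    convert this using 1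
    simp
    ring
  have hc : Continuous fun ω : ℝ => Complex.I * r.eval (Complex.I * (ω : ℂ)) :=
    continuous_const.mul (continuous_eval_axis r)
  have h1 : 0 ≤ Complex.I * r.eval (Complex.I * (a : ℂ)) := by
    refine ge_of_tendsto (hc.continuousWithinAt (s := Set.Ioi a) (x := a)) ?_
    filter_upwards [self_mem_nhdsWithin] with ω hω
    exact nonneg_of_ofReal_mul_nonneg (sub_pos.2 hω) (hv ω)
  have h2 : Complex.I * r.eval (Complex.I * (a : ℂ)) ≤ 0 := by
    refine le_of_tendsto (hc.continuousWithinAt (s := Set.Iio a) (x := a)) ?_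
    filter_upwards [self_mem_nhdsWithin] with ω hω
    have := hv ω
    rw [← neg_sub a ω, Complex.ofReal_neg, neg_mul, ← mul_neg] at this
    exact neg_nonneg.1 (nonneg_of_ofReal_mul_nonneg (sub_pos.2 hω) this)
  exact (mul_eq_zero.1 (le_antisymm h2 h1)).resolve_left Complex.I_ne_zero

/-- Roots outside the imaginary axis come in pairs `a`, `-a^*`, and roots on the axis are multiple;
splitting off such pairs, one factor of the form `(s - a) (s - a)^H` at a time, factorizes the
polynomial. -/
theorem exists_poly_spectral_factor (p : ℂ[X])
    (h : ∀ ω : ℝ, 0 ≤ p.eval (Complex.I * (ω : ℂ))) : ∃ g : ℂ[X], p = g * polyParaConj g := by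
  induction hn : p.natDegree using Nat.strong_induction_on generalizing p with
  | _ N ih =>
    by_cases hN : p.natDegree = 0
    · obtain ⟨c, rfl⟩ := Polynomial.natDegree_eq_zero.1 hN
      have hc : 0 ≤ c := by simpa using h 0
      obtain ⟨x, hx, rfl⟩ : ∃ x : ℝ, 0 ≤ x ∧ (x : ℂ) = c := by
        rw [Complex.nonneg_iff] at hc
        exact ⟨c.re, hc.1, Complex.ext rfl hc.2⟩
      refine ⟨C (Real.sqrt x : ℂ), ?_⟩
      rw [polyParaConj_C, ← C_mul]
      congr 1
      rw [Complex.star_def, Complex.conj_ofReal, ← Complex.ofReal_mul, Real.mul_self_sqrt hx]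
    · have hp0 : p ≠ 0 := by
        rintro rfl
        simp at hN
      obtain ⟨a, ha⟩ := IsAlgClosed.exists_root p
        (fun h0 => hN (Polynomial.natDegree_eq_of_degree_eq_some h0))
      obtain ⟨r, hr⟩ := Polynomial.dvd_iff_isRoot.2 ha
      have hroot : r.eval (-star a) = 0 := by
        by_cases hre : a.re = 0
        · have hai : a = Complex.I * (a.im : ℂ) := by
            apply Complex.ext <;> simp [hre]
          rw [hai, neg_star_I_mul]
          exact eval_quotient_eq_zero h (by rw [← hai]; exact hr)
        · have h1 : p.eval (-star a) = 0 := by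
            rw [← polyParaConj_eq_self h, eval_polyParaConj, star_neg, star_star, neg_neg, ha,
              star_zero]
          rw [hr, Polynomial.eval_mul] at h1
          refine (mul_eq_zero.1 h1).resolve_left fun h2 => hre ?_
          have := congrArg Complex.re h2
          simp at this
          linarith
      obtain ⟨t, ht⟩ := Polynomial.dvd_iff_isRoot.2 hroot
      have hfac : p = (X - C a) * polyParaConj (X - C a) * (-t) := by
        rw [hr, ht, map_sub, polyParaConj_X, polyParaConj_C]
        simp only [map_neg]
        ring
      have ht0 : ∀ ω : ℝ, 0 ≤ (-t).eval (Complex.I * (ω : ℂ)) := by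
        refine eval_axis_nonneg_of_eventually ?_
        filter_upwards [eventually_eval_axis_ne_zero (Polynomial.X_sub_C_ne_zero a)] with ω hω
        have := h ω
        rw [hfac, Polynomial.eval_mul, Polynomial.eval_mul, eval_polyParaConj_axis,
          Complex.star_def, Complex.mul_conj] at this
        exact nonneg_of_ofReal_mul_nonneg (Complex.normSq_pos.2 hω) this
      have hdeg : (-t).natDegree < N := by
        have ht' : t ≠ 0 := by
          rintro rfl
          simp at ht
          exact hp0 (by rw [hr, ht, mul_zero])
        rw [← hn, hr, ht, natDegree_mul (X_sub_C_ne_zero _) (mul_ne_zero (X_sub_C_ne_zero _) ht'),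
          natDegree_mul (X_sub_C_ne_zero _) ht', natDegree_X_sub_C, natDegree_X_sub_C,
          natDegree_neg]
        omega
      obtain ⟨g, hg⟩ := ih _ hdeg (-t) ht0 rfl
      refine ⟨(X - C a) * g, ?_⟩
      rw [map_mul, hfac]
      conv_lhs => rw [hg]
      ring

theorem exists_spectral_factor (f : RatFunc ℂ)
    (h : ∀ᶠ ω : ℝ in cofinite, 0 ≤ value (Complex.I * ω) f) :
    ∃ g : RatFunc ℂ, f = g * ratParaConj g := by
  obtain ⟨g, hg⟩ := exists_poly_spectral_factor (f.num * polyParaConj f.denom)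
    (eval_axis_nonneg_of_eventually (by
      filter_upwards [h, eventually_regularAt f] with ω hω hreg
      have hd : f.num.eval (Complex.I * ω) =
          value (Complex.I * ω) f * f.denom.eval (Complex.I * ω) := by
        rw [value_eq, div_mul_cancel₀ _ hreg]
      rw [Polynomial.eval_mul, eval_polyParaConj_axis, hd, mul_assoc]
      exact mul_nonneg hω (mul_star_self_nonneg _)))
  have hd := RatFunc.algebraMap_ne_zero f.denom_ne_zero
  have hd' := RatFunc.algebraMap_ne_zero (polyParaConj_ne_zero f.denom_ne_zero)
  refine ⟨algebraMap _ _ g / algebraMap _ _ f.denom, ?_⟩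
  rw [ratParaConj_div, div_mul_div_comm, ← map_mul, ← hg, map_mul, mul_div_mul_right _ _ hd',
    RatFunc.num_div_denom]

/-! ### Values and para-conjugates of rational matrices -/

section MatrixCalculus

variable {l p q : Type*}

theorem paraConj_paraConj (X : RatMat p q) : paraConj (paraConj X) = X := by
  ext i j : 2
  exact ratParaConj_ratParaConj _

theorem paraConj_add (X Y : RatMat p q) : paraConj (X + Y) = paraConj X + paraConj Y := by
  ext i j : 2
  exact map_add ratParaConj _ _

theorem paraConj_neg (X : RatMat p q) : paraConj (-X) = -paraConj X := by
  ext i j : 2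
  exact map_neg ratParaConj _

theorem paraConj_sub (X Y : RatMat p q) : paraConj (X - Y) = paraConj X - paraConj Y := by
  ext i j : 2
  exact map_sub ratParaConj _ _

theorem paraConj_smul (f : RatFunc ℂ) (X : RatMat p q) :
    paraConj (f • X) = ratParaConj f • paraConj X := by
  ext i j : 2
  exact map_mul ratParaConj _ _

theorem paraConj_zero : paraConj (0 : RatMat p q) = 0 := by
  ext i j : 2
  exact map_zero ratParaConj

theorem paraConj_one [DecidableEq p] : paraConj (1 : RatMat p p) = 1 := by
  rw [paraConj, Matrix.map_one _ (map_zero _) (map_one _), transpose_one]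

theorem paraConj_mul [Fintype q] (X : RatMat p q) (Y : RatMat q l) :
    paraConj (X * Y) = paraConj Y * paraConj X := by
  rw [paraConj, Matrix.map_mul, transpose_mul]
  rfl

theorem paraConj_const (M : Matrix p q ℂ) : paraConj (const M) = const Mᴴ := by
  ext i j : 2
  exact ratParaConj_C _

theorem paraConj_fromCols (X : RatMat p q) (Y : RatMat p l) :
    paraConj (fromCols X Y) = fromRows (paraConj X) (paraConj Y) := by
  ext (i | i) j : 2 <;> rfl

theorem paraConj_fromBlocks {m : Type*} (X : RatMat p q) (Y : RatMat p l) (Z : RatMat m q)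
    (T : RatMat m l) : paraConj (fromBlocks X Y Z T) =
      fromBlocks (paraConj X) (paraConj Z) (paraConj Y) (paraConj T) := by
  ext (i | i) (j | j) : 2 <;> rfl

theorem const_add (M N : Matrix p q ℂ) : const (M + N) = const M + const N := by
  ext i j : 2
  exact map_add RatFunc.C _ _

theorem const_neg (M : Matrix p q ℂ) : const (-M) = -const M := by
  ext i j : 2
  exact map_neg RatFunc.C _

theorem const_mul [Fintype q] (M : Matrix p q ℂ) (N : Matrix q l ℂ) :
    const (M * N) = const M * const N := Matrix.map_mul

theorem const_zero : const (0 : Matrix p q ℂ) = 0 := by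
  ext i j : 2
  exact map_zero RatFunc.C

theorem const_one [DecidableEq p] : const (1 : Matrix p p ℂ) = 1 :=
  Matrix.map_one _ (map_zero _) (map_one _)

theorem const_fromBlocks {m : Type*} (M : Matrix p q ℂ) (N : Matrix p l ℂ) (K : Matrix m q ℂ)
    (L : Matrix m l ℂ) :
    const (fromBlocks M N K L) = fromBlocks (const M) (const N) (const K) (const L) :=
  fromBlocks_map _ _ _ _ _

theorem regularAt_paraConj {X : RatMat p q} {ω : ℝ}
    (h : ∀ i j, RegularAt (Complex.I * ω) (X i j)) (i : q) (j : p) :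
    RegularAt (Complex.I * ω) (paraConj X i j) := (h j i).ratParaConj

theorem onAxis_paraConj {X : RatMat p q} {ω : ℝ}
    (h : ∀ i j, RegularAt (Complex.I * ω) (X i j)) : onAxis (paraConj X) ω = (onAxis X ω)ᴴ := by
  ext i j : 2
  exact value_ratParaConj (h j i)

theorem regularAt_mul [Fintype q] {X : RatMat p q} {Y : RatMat q l} {s : ℂ}
    (hX : ∀ i j, RegularAt s (X i j)) (hY : ∀ i j, RegularAt s (Y i j)) (i : p) (j : l) :
    RegularAt s ((X * Y) i j) := .sum _ fun k => (hX i k).mul (hY k j)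

theorem valAt_mul [Fintype q] {X : RatMat p q} {Y : RatMat q l} {s : ℂ}
    (hX : ∀ i j, RegularAt s (X i j)) (hY : ∀ i j, RegularAt s (Y i j)) :
    valAt (X * Y) s = valAt X s * valAt Y s := by
  ext i j : 2
  exact (value_sum _ fun k => (hX i k).mul (hY k j)).trans
    (Finset.sum_congr rfl fun k _ => value_mul (hX i k) (hY k j))

theorem regularAt_one_apply [DecidableEq p] (s : ℂ) (i j : p) :
    RegularAt s ((1 : RatMat p p) i j) := by
  rw [one_apply]
  split_ifs
  · exact regularAt_one
  · exact regularAt_zero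

theorem valAt_one [DecidableEq p] (s : ℂ) : valAt (1 : RatMat p p) s = 1 :=
  Matrix.map_one _ (RatFunc.eval_zero _ _) (RatFunc.eval_one _ _)

theorem regularAt_one_sub [DecidableEq p] {X : RatMat p p} {s : ℂ}
    (h : ∀ i j, RegularAt s (X i j)) (i j : p) : RegularAt s ((1 - X) i j) :=
  (regularAt_one_apply s i j).sub (h i j)

theorem valAt_one_sub [DecidableEq p] {X : RatMat p p} {s : ℂ}
    (h : ∀ i j, RegularAt s (X i j)) : valAt (1 - X) s = 1 - valAt X s := by
  rw [← valAt_one s]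
  ext i j : 2
  exact value_sub (regularAt_one_apply s i j) (h i j)

theorem onAxis_one_sub_mul_paraConj [Fintype q] [DecidableEq p] {X : RatMat p q} {ω : ℝ}
    (h : ∀ i j, RegularAt (Complex.I * ω) (X i j)) :
    onAxis (1 - X * paraConj X) ω = 1 - onAxis X ω * (onAxis X ω)ᴴ := by
  rw [onAxis, valAt_one_sub (regularAt_mul h (regularAt_paraConj h)),
    valAt_mul h (regularAt_paraConj h), ← onAxis_paraConj h]
  rfl

theorem onAxis_one_sub_paraConj_mul [Fintype p] [DecidableEq q] {X : RatMat p q} {ω : ℝ}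
    (h : ∀ i j, RegularAt (Complex.I * ω) (X i j)) :
    onAxis (1 - paraConj X * X) ω = 1 - (onAxis X ω)ᴴ * onAxis X ω := by
  rw [onAxis, valAt_one_sub (regularAt_mul (regularAt_paraConj h) h),
    valAt_mul (regularAt_paraConj h) h, ← onAxis_paraConj h]
  rfl

end MatrixCalculus

theorem CondH1.regularAt_axis {p q : Type*} {X : RatMat p q} (h : CondH1 X) (ω : ℝ) (i : p)
    (j : q) : RegularAt (Complex.I * ω) (X i j) := fun h0 => by
  have := h.1 _ ⟨i, j, h0⟩
  simp at this

/-! ### Spectral factorization of positive definite matrices -/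

/-- The form `v ↦ v W v^H` on row vectors over `ℂ(s)`. -/
def paraForm {p : Type*} [Fintype p] (W : RatMat p p) (v : p → RatFunc ℂ) : RatFunc ℂ :=
  ∑ i, ∑ j, v i * W i j * ratParaConj (v j)

theorem paraForm_cons {n : ℕ} (W : RatMat (Fin (n + 1)) (Fin (n + 1))) (x : RatFunc ℂ)
    (v : Fin n → RatFunc ℂ) : paraForm W (Fin.cons x v) =
      x * W 0 0 * ratParaConj x + x * (∑ j, W 0 j.succ * ratParaConj (v j)) +
        (∑ i, v i * W i.succ 0) * ratParaConj x +
        paraForm (fun i j => W i.succ j.succ) v := by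
  simp only [paraForm, Fin.sum_univ_succ, Fin.cons_zero, Fin.cons_succ, Finset.sum_add_distrib,
    Finset.mul_sum, Finset.sum_mul, mul_assoc]
  ring

/-- A Cholesky factorization, by induction on Schur complements of the leading entry. That the
form takes values of the form `g g^H` only is what provides the square roots of the pivots. -/
theorem exists_factor_of_paraForm : ∀ {n : ℕ} (W : RatMat (Fin n) (Fin n)), paraConj W = W →
    (∀ v, ∃ g, paraForm W v = g * ratParaConj g) → (∀ v, paraForm W v = 0 → v = 0) →
    ∃ M : RatMat (Fin n) (Fin n), W = M * paraConj M
  | 0, W, _, _, _ => ⟨0, Subsingleton.elim _ _⟩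
  | n + 1, W, hW, hsq, hdef => by
    have hσ : ∀ i j, ratParaConj (W i j) = W j i := fun i j => congrFun (congrFun hW j) i
    have hpivot : paraForm W (Fin.cons 1 0) = W 0 0 := by
      rw [paraForm_cons]
      simp [paraForm]
    obtain ⟨f, hf⟩ := hsq (Fin.cons 1 0)
    rw [hpivot] at hf
    have ha : W 0 0 ≠ 0 := fun h => one_ne_zero
      (congrFun (hdef (Fin.cons 1 0) (hpivot.trans h)) 0)
    have hf0 : f ≠ 0 := by
      rintro rfl
      exact ha (by rw [hf, zero_mul])
    have hf1 : ratParaConj f ≠ 0 := (_root_.map_ne_zero _).2 hf0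
    let S : RatMat (Fin n) (Fin n) := fun i j =>
      W i.succ j.succ - W i.succ 0 * W 0 j.succ / W 0 0
    -- Completing the square: this leading coordinate minimizes the form for given `v`.
    have hform : ∀ v, paraForm S v =
        paraForm W (Fin.cons (-(∑ i, v i * W i.succ 0) / W 0 0) v) := fun v => by
      have hc : ratParaConj (∑ i, v i * W i.succ 0) = ∑ j, W 0 j.succ * ratParaConj (v j) := by
        rw [map_sum]
        exact Finset.sum_congr rfl fun i _ => by rw [map_mul, hσ, mul_comm]
      have hS : paraForm S v = paraForm (fun i j => W i.succ j.succ) v -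
          (∑ i, v i * W i.succ 0) * (∑ j, W 0 j.succ * ratParaConj (v j)) / W 0 0 := by
        rw [Finset.sum_mul_sum, Finset.sum_div]
        simp only [paraForm]
        rw [← Finset.sum_sub_distrib]
        refine Finset.sum_congr rfl fun i _ => ?_
        rw [Finset.sum_div, ← Finset.sum_sub_distrib]
        refine Finset.sum_congr rfl fun j _ => ?_
        simp only [S]
        ring
      rw [hS, paraForm_cons, map_div₀, map_neg, hc, hσ]
      field_simp
      ring
    obtain ⟨M, hM⟩ := exists_factor_of_paraForm S
      (by
        ext i j : 2
        change ratParaConj (S j i) = S i j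
        simp only [S, map_sub, map_div₀, map_mul, hσ]
        ring)
      (fun v => hform v ▸ hsq _)
      (fun v hv => by
        have h := hdef _ ((hform v).symm.trans hv)
        funext i
        exact congrFun h i.succ)
    refine ⟨of (Fin.cons (Fin.cons f 0) fun i => Fin.cons (W i.succ 0 / ratParaConj f) (M i)), ?_⟩
    have hMS : ∀ i j, ∑ k, M i k * ratParaConj (M j k) =
        W i.succ j.succ - W i.succ 0 * W 0 j.succ / W 0 0 := fun i j =>
      (congrFun (congrFun hM i) j).symm
    ext i j : 2
    rw [mul_apply, Fin.sum_univ_succ]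
    refine Fin.cases ?_ (fun i => ?_) i <;> refine Fin.cases ?_ (fun j => ?_) j
    · simp [paraConj, hf]
    · simp [paraConj, hσ, ratParaConj_ratParaConj]
      field_simp
    · simp [paraConj, hf1]
    · simp only [paraConj, transpose_apply, map_apply, of_apply, Fin.cons_zero, Fin.cons_succ, hMS,
        map_div₀, hσ, ratParaConj_ratParaConj]
      rw [hf]
      field_simp
      ring

/-- On the imaginary axis the form of `W` takes the values of the form of `W(iω)`. -/
theorem value_paraForm {p : Type*} [Fintype p] {W : RatMat p p} {v : p → RatFunc ℂ} {ω : ℝ}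
    (hW : ∀ i j, RegularAt (Complex.I * ω) (W i j)) (hv : ∀ i, RegularAt (Complex.I * ω) (v i)) :
    value (Complex.I * ω) (paraForm W v) =
      star (fun i => star (value (Complex.I * ω) (v i))) ⬝ᵥ
        (onAxis W ω *ᵥ fun i => star (value (Complex.I * ω) (v i))) := by
  have hr : ∀ i j, RegularAt (Complex.I * ω) (v i * W i j * ratParaConj (v j)) := fun i j =>
    ((hv i).mul (hW i j)).mul (hv j).ratParaConj
  rw [paraForm, value_sum _ fun i => RegularAt.sum _ (hr i), dotProduct]
  refine Finset.sum_congr rfl fun i _ => ?_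
  rw [value_sum _ (hr i), mulVec, dotProduct, Finset.mul_sum]
  refine Finset.sum_congr rfl fun j _ => ?_
  rw [value_mul ((hv i).mul (hW i j)) (hv j).ratParaConj, value_mul (hv i) (hW i j),
    value_ratParaConj (hv j), Pi.star_apply, star_star, mul_assoc]
  rfl

theorem exists_factor_of_posDef {n : ℕ} {W : RatMat (Fin n) (Fin n)} (hW : paraConj W = W)
    (hreg : ∀ (ω : ℝ) i j, RegularAt (Complex.I * ω) (W i j))
    (hpos : ∀ ω, (onAxis W ω).PosDef) : ∃ M : RatMat (Fin n) (Fin n), W = M * paraConj M := by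
  have hev : ∀ v : Fin n → RatFunc ℂ, ∀ᶠ ω : ℝ in cofinite, ∀ i,
      RegularAt (Complex.I * ω) (v i) := fun v => eventually_all.2 fun i => eventually_regularAt _
  refine exists_factor_of_paraForm W hW (fun v => exists_spectral_factor _ ?_) fun v hv => ?_
  · filter_upwards [hev v] with ω hω
    rw [value_paraForm (hreg ω) hω]
    exact (hpos ω).posSemidef.dotProduct_mulVec_nonneg _
  · by_contra hne
    obtain ⟨i, hi⟩ := Function.ne_iff.1 hne
    obtain ⟨ω, hω, hvi⟩ := ((hev v).and (eventually_value_ne_zero hi)).exists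
    have h := (hpos ω).dotProduct_mulVec_pos (x := fun i => star (value (Complex.I * ω) (v i)))
      (fun h => hvi (star_eq_zero.1 (congrFun h i)))
    rw [← value_paraForm (hreg ω) hω, hv, value, RatFunc.eval_zero] at h
    exact h.false

/-! ### Stabilization by an all-pass factor -/

theorem exists_eq_mul_of_half_planes {d : ℂ[X]} (hd : d ≠ 0) : ∃ u r : ℂ[X], d = u * r ∧
    (∀ s, u.eval s = 0 → 0 < s.re) ∧ ∀ s, r.eval s = 0 → s.re ≤ 0 := by
  have hroot : ∀ (m : Multiset ℂ) (s : ℂ),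
      ((m.map fun a => Polynomial.X - C a).prod).eval s = 0 → s ∈ m := fun m s h => by
    rw [Polynomial.eval_multiset_prod, Multiset.prod_eq_zero_iff, Multiset.map_map] at h
    obtain ⟨a, ha, h⟩ := Multiset.mem_map.1 h
    rw [Function.comp_apply, Polynomial.eval_sub, eval_X, eval_C, sub_eq_zero] at h
    rwa [h]
  refine ⟨((d.roots.filter fun a => 0 < a.re).map fun a => Polynomial.X - C a).prod,
    C d.leadingCoeff *
      ((d.roots.filter fun a => ¬ 0 < a.re).map fun a => Polynomial.X - C a).prod, ?_,
    fun s hs => (Multiset.mem_filter.1 (hroot _ s hs)).2, fun s hs => ?_⟩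
  · conv_lhs => rw [(IsAlgClosed.splits d).eq_prod_roots]
    rw [mul_left_comm, ← Multiset.prod_add, ← Multiset.map_add, Multiset.filter_add_not]
  · rw [Polynomial.eval_mul, eval_C] at hs
    exact not_lt.1 (Multiset.mem_filter.1 (hroot _ s
      ((mul_eq_zero.1 hs).resolve_left (leadingCoeff_ne_zero.2 hd)))).2

theorem exists_common_denominator {p q : Type*} [Finite p] [Finite q] (X : RatMat p q) :
    ∃ d : ℂ[X], d ≠ 0 ∧ ∀ i j, (X i j).denom ∣ d := by
  have := Fintype.ofFinite p
  have := Fintype.ofFinite q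
  refine ⟨∏ i, ∏ j, (X i j).denom, Finset.prod_ne_zero_iff.2 fun i _ =>
    Finset.prod_ne_zero_iff.2 fun j _ => (X i j).denom_ne_zero, fun i j => ?_⟩
  have h1 : (X i j).denom ∣ ∏ j, (X i j).denom :=
    Finset.dvd_prod_of_mem (fun j => (X i j).denom) (Finset.mem_univ j)
  have h2 : ∏ j, (X i j).denom ∣ ∏ i, ∏ j, (X i j).denom :=
    Finset.dvd_prod_of_mem (fun i => ∏ j, (X i j).denom) (Finset.mem_univ i)
  exact dvd_trans h1 h2

/-- Multiplication by an all-pass function that has zeros at the poles of `X` in the open right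
half-plane moves these poles to their mirror images in the open left half-plane. -/
theorem exists_stabilizing_allpass {p q : Type*} [Finite p] [Finite q] (X : RatMat p q) :
    ∃ b : RatFunc ℂ, b * ratParaConj b = 1 ∧
      ∀ s : ℂ, 0 < s.re → ∀ i j, RegularAt s ((b • X) i j) := by
  obtain ⟨d, hd0, hdvd⟩ := exists_common_denominator X
  obtain ⟨u, r, hsplit, hu, hr⟩ := exists_eq_mul_of_half_planes hd0
  have hu0 : u ≠ 0 := fun h => hd0 (by rw [hsplit, h, zero_mul])
  have hr0 : r ≠ 0 := fun h => hd0 (by rw [hsplit, h, mul_zero])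
  have hu1 := RatFunc.algebraMap_ne_zero hu0
  have hr1 := RatFunc.algebraMap_ne_zero hr0
  have hg1 := RatFunc.algebraMap_ne_zero (polyParaConj_ne_zero hu0)
  refine ⟨algebraMap _ _ u / algebraMap _ _ (polyParaConj u), ?_, fun s hs i j => ?_⟩
  · rw [ratParaConj_div, polyParaConj_polyParaConj, div_mul_div_cancel₀ hg1, div_self hu1]
  · obtain ⟨t, ht⟩ := (RatFunc.denom_dvd hd0).1 (hdvd i j)
    refine .of_eq_div (p := t) (q := polyParaConj u * r) ?_ ?_
    · rw [Polynomial.eval_mul, eval_polyParaConj]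
      refine mul_ne_zero (fun h => ?_) fun h => (hr s h).not_gt hs
      have := hu _ (star_eq_zero.1 h)
      simp at this
      linarith
    · change _ / _ * X i j = _
      rw [ht, hsplit, map_mul, map_mul, div_mul_div_comm, mul_left_comm,
        mul_div_mul_left _ _ hu1]

/-! ### Stable paraunitary matrices -/

section Paraunitary

variable {p q : Type*} [Fintype q] [DecidableEq p] {H : RatMat p q}

theorem norm_value_le_one {ω : ℝ} (hH : H * paraConj H = 1)
    (hreg : ∀ i j, RegularAt (Complex.I * ω) (H i j)) (i : p) (j : q) :
    ‖value (Complex.I * ω) (H i j)‖ ≤ 1 := by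
  have h1 : onAxis H ω * (onAxis H ω)ᴴ = 1 := by
    rw [← onAxis_paraConj hreg, onAxis, onAxis, ← valAt_mul hreg (regularAt_paraConj hreg), hH,
      valAt_one]
  have h2 : ∑ k, ‖onAxis H ω i k‖ ^ 2 = 1 := by
    have h3 := congrFun (congrFun h1 i) i
    rw [mul_apply, one_apply_eq] at h3
    simp only [conjTranspose_apply, Complex.star_def, Complex.mul_conj, Complex.normSq_eq_norm_sq]
      at h3
    exact_mod_cast h3
  have h4 : ‖onAxis H ω i j‖ ^ 2 ≤ 1 := h2 ▸
    Finset.single_le_sum (f := fun k => ‖onAxis H ω i k‖ ^ 2) (fun _ _ => by positivity)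
      (Finset.mem_univ j)
  exact (sq_le_one_iff₀ (norm_nonneg _)).1 h4

theorem norm_num_le_norm_denom [Finite p] (hH : H * paraConj H = 1) (i : p) (j : q) (ω : ℝ) :
    ‖(H i j).num.eval (Complex.I * ω)‖ ≤ ‖(H i j).denom.eval (Complex.I * ω)‖ := by
  have hcl : IsClosed {ω : ℝ | ‖(H i j).num.eval (Complex.I * (ω : ℂ))‖ ≤
      ‖(H i j).denom.eval (Complex.I * (ω : ℂ))‖} :=
    isClosed_le (continuous_eval_axis _).norm (continuous_eval_axis _).norm
  have hev : ∀ᶠ ω : ℝ in cofinite, ‖(H i j).num.eval (Complex.I * (ω : ℂ))‖ ≤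
      ‖(H i j).denom.eval (Complex.I * (ω : ℂ))‖ := by
    filter_upwards [eventually_all.2 fun i => eventually_all.2 fun j =>
      eventually_regularAt (H i j)] with ω hω
    have h := norm_value_le_one hH hω i j
    rwa [value_eq, norm_div, div_le_one (norm_pos_iff.2 (hω i j))] at h
  have hd := (Filter.mem_cofinite.1 hev).countable.dense_compl ℝ
  rw [compl_compl] at hd
  have := hd ω
  rwa [IsClosed.closure_eq hcl] at this

/-- A paraunitary matrix is contractive on the imaginary axis, so it cannot have poles there. -/
theorem regularAt_axis_of_paraunitary [Finite p] (hH : H * paraConj H = 1) (ω : ℝ) (i : p)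
    (j : q) : RegularAt (Complex.I * ω) (H i j) := fun h0 => by
  have h1 := norm_num_le_norm_denom hH i j ω
  rw [h0, norm_zero, norm_le_zero_iff] at h1
  obtain ⟨a, b, hab⟩ := (H i j).isCoprime_num_denom
  have h2 := congrArg (Polynomial.eval (Complex.I * (ω : ℂ))) hab
  rw [Polynomial.eval_add, Polynomial.eval_mul, Polynomial.eval_mul, h0, h1] at h2
  simp at h2

end Paraunitary

theorem tendsto_axis_cobounded :
    Tendsto (fun ω : ℝ => Complex.I * (ω : ℂ)) atTop (Bornology.cobounded ℂ) := by
  rw [← tendsto_norm_atTop_iff_cobounded]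
  simpa using tendsto_abs_atTop_atTop

theorem degree_le_of_norm_le_on_axis {p q : ℂ[X]}
    (h : ∀ ω : ℝ, ‖p.eval (Complex.I * (ω : ℂ))‖ ≤ ‖q.eval (Complex.I * (ω : ℂ))‖) :
    p.degree ≤ q.degree := by
  by_contra! hlt
  have hp : p ≠ 0 := by
    rintro rfl
    simp at hlt
  have ho := (Polynomial.isLittleO_cobounded_of_degree_lt hlt).comp_tendsto tendsto_axis_cobounded
  -- A bound `‖q‖ ≤ ‖p‖ / 2` far up the axis contradicts `‖p‖ ≤ ‖q‖` unless `p` vanishes there.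
  have hle := ho.bound (c := 1 / 2) (by norm_num)
  obtain ⟨ω, h1, h2⟩ := (hle.and (((eventually_eval_axis_ne_zero hp).filter_mono
    atTop_le_cofinite))).exists
  have h3 := norm_pos_iff.2 h2
  have h4 := h ω
  simp only [Function.comp_apply] at h1
  linarith

/-- A proper rational function without poles in the closed right half-plane is bounded there. -/
theorem exists_norm_value_le {f : RatFunc ℂ} (hdeg : f.num.degree ≤ f.denom.degree)
    (hreg : ∀ s : ℂ, 0 ≤ s.re → RegularAt s f) :
    ∃ M : ℝ, ∀ s : ℂ, 0 ≤ s.re → ‖value s f‖ ≤ M := by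
  obtain ⟨c, hc⟩ := (Polynomial.isBigO_cobounded_of_degree_le hdeg).bound
  obtain ⟨r, -, hr⟩ := (Filter.hasBasis_cobounded_norm (E := ℂ)).eventually_iff.1 hc
  have hcomp : IsCompact (Metric.closedBall (0 : ℂ) r ∩ {s | 0 ≤ s.re}) :=
    (isCompact_closedBall 0 r).inter_right (isClosed_le continuous_const Complex.continuous_re)
  have hcont : ContinuousOn (fun s => value s f) (Metric.closedBall (0 : ℂ) r ∩ {s | 0 ≤ s.re}) :=
    f.num.continuous.continuousOn.div f.denom.continuous.continuousOn fun s hs => hreg s hs.2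
  obtain ⟨M, hM⟩ := hcomp.exists_bound_of_continuousOn hcont
  refine ⟨max M c, fun s hs => ?_⟩
  by_cases hsr : ‖s‖ ≤ r
  · exact (hM s ⟨by simpa using hsr, hs⟩).trans (le_max_left _ _)
  · have h1 := hr (x := s) (not_le.1 hsr).le
    rw [← div_le_iff₀ (norm_pos_iff.2 (hreg s hs)), ← norm_div] at h1
    exact h1.trans (le_max_right _ _)

/-- As a rational matrix has finitely many poles, stability gives a stability margin. -/
theorem condH1_of_regularAt {p q : Type*} [Finite p] [Finite q] {X : RatMat p q}
    (h : ∀ s : ℂ, 0 ≤ s.re → ∀ i j, RegularAt s (X i j)) : CondH1 X := by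
  have hpole : ∀ s, IsPole X s → s.re < 0 := fun s ⟨i, j, hs⟩ =>
    not_le.1 fun hre => h s hre i j hs
  refine ⟨hpole, ?_⟩
  obtain ⟨d, hd0, hdvd⟩ := exists_common_denominator X
  have hfin : {s | IsPole X s}.Finite :=
    (Polynomial.finite_setOfPred_isRoot hd0).subset fun s ⟨i, j, hs⟩ => hs.dvd (hdvd i j)
  have hev : ∀ᶠ τ : ℝ in 𝓝[>] 0, ∀ s ∈ {s | IsPole X s}, s.re < -τ := by
    refine (Filter.eventually_all_finite hfin).2 fun s hs => ?_
    filter_upwards [nhdsWithin_le_nhds (Iio_mem_nhds (neg_pos.2 (hpole s hs)))] with τ hτ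
    exact lt_neg.1 hτ
  obtain ⟨τ, hτ, hτ0⟩ := (hev.and self_mem_nhdsWithin).exists
  refine ⟨τ, hτ0, fun i j => ?_⟩
  have han : ∀ r : ℂ[X], AnalyticOnNhd ℂ (fun s => r.eval s) {s | -τ < s.re} := fun r =>
    (AnalyticOnNhd.eval_polynomial r).mono (Set.subset_univ _)
  exact (han (X i j).num).div (han (X i j).denom) fun s hs h0 => (hτ s ⟨i, j, h0⟩).not_gt hs

theorem admissible_of_paraunitary {n ny nz nzh : ℕ}
    {H : RatMat (Fin n ⊕ Fin nzh) (Fin ny ⊕ Fin nz)} (hsq : n + nzh = ny + nz)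
    (hH : H * paraConj H = 1) (hreg : ∀ s : ℂ, 0 < s.re → ∀ i j, RegularAt s (H i j)) :
    Admissible H := by
  have hreg' : ∀ s : ℂ, 0 ≤ s.re → ∀ i j, RegularAt s (H i j) := fun s hs i j => by
    rcases hs.lt_or_eq with hs | hs
    · exact hreg s hs i j
    · have hsi : s = Complex.I * (s.im : ℂ) := by
        apply Complex.ext <;> simp [← hs]
      rw [hsi]
      exact regularAt_axis_of_paraunitary hH _ i j
  refine ⟨hsq, condH1_of_regularAt hreg', ?_, ?_, hH⟩
  · choose M hM using fun i j => exists_norm_value_le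
      (degree_le_of_norm_le_on_axis (norm_num_le_norm_denom hH i j)) fun s hs => hreg' s hs i j
    refine ⟨∑ i, ∑ j, |M i j|, fun s hs i j => (hM i j s hs.le).trans ((le_abs_self _).trans ?_)⟩
    exact (Finset.single_le_sum (f := fun j => |M i j|) (fun _ _ => abs_nonneg _)
      (Finset.mem_univ j)).trans (Finset.single_le_sum (f := fun i => ∑ j, |M i j|)
        (fun _ _ => Finset.sum_nonneg fun _ _ => abs_nonneg _) (Finset.mem_univ i))
  · exact (mul_eq_one_comm_of_card_eq _ _ _ (by simpa using hsq)).1 hH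

/-! ### Lossless extension of a strict contraction -/

/-- The unitary dilation of the co-isometry `R`, with the lower block row multiplied by `b`. -/
def dilation {p q : Type*} [Fintype p] [DecidableEq q] (b : RatFunc ℂ) (R : RatMat p q) :
    RatMat (p ⊕ q) (q ⊕ p) :=
  fromBlocks R 0 (b • (1 - paraConj R * R)) (-(b • paraConj R))

theorem dilation_mul_paraConj {p q : Type*} [Fintype p] [DecidableEq p] [Fintype q] [DecidableEq q]
    {b : RatFunc ℂ} {R : RatMat p q} (hb : b * ratParaConj b = 1) (hR : R * paraConj R = 1) :
    dilation b R * paraConj (dilation b R) = 1 := by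
  have h1 : R * (1 - paraConj R * R) = 0 := by
    rw [Matrix.mul_sub, ← Matrix.mul_assoc, hR, Matrix.mul_one, Matrix.one_mul, sub_self]
  have h2 : (1 - paraConj R * R) * paraConj R = 0 := by
    rw [Matrix.sub_mul, Matrix.mul_assoc, hR, Matrix.mul_one, Matrix.one_mul, sub_self]
  have h3 : (1 - paraConj R * R) * (1 - paraConj R * R) = 1 - paraConj R * R := by
    rw [Matrix.mul_sub, Matrix.mul_one, ← Matrix.mul_assoc, h2, Matrix.zero_mul, sub_zero]
  rw [dilation, paraConj_fromBlocks, fromBlocks_multiply]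
  simp only [paraConj_neg, paraConj_smul, paraConj_sub, paraConj_mul, paraConj_one,
    paraConj_paraConj, paraConj_zero, Matrix.mul_smul, Matrix.smul_mul, Matrix.mul_zero,
    Matrix.zero_mul, add_zero, Matrix.mul_neg, Matrix.neg_mul, neg_neg, smul_neg, neg_zero, smul_smul, hR, h1,
    h2, h3, smul_zero, hb, mul_comm (ratParaConj b), one_smul, sub_add_cancel, fromBlocks_one]

theorem exists_admissible_extension {n ny : ℕ} {H11 : RatMat (Fin n) (Fin ny)} (h1 : CondH1 H11)
    (hc : ∀ ω : ℝ, (1 - onAxis H11 ω * (onAxis H11 ω)ᴴ).PosDef) :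
    ∃ (nz nzh : ℕ) (H : RatMat (Fin n ⊕ Fin nzh) (Fin ny ⊕ Fin nz)),
      Admissible H ∧ H.toBlocks₁₁ = H11 := by
  have hreg := h1.regularAt_axis
  obtain ⟨M, hM⟩ := exists_factor_of_posDef (W := 1 - H11 * paraConj H11)
    (by rw [paraConj_sub, paraConj_one, paraConj_mul, paraConj_paraConj])
    (fun ω => regularAt_one_sub (regularAt_mul (hreg ω) (regularAt_paraConj (hreg ω))))
    (fun ω => by
      rw [onAxis_one_sub_mul_paraConj (hreg ω)]
      exact hc ω)
  obtain ⟨b, hb, hbM⟩ := exists_stabilizing_allpass M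
  set R : RatMat (Fin n) (Fin ny ⊕ Fin n) := fromCols H11 (b • M) with hRdef
  have hR : R * paraConj R = 1 := by
    rw [hRdef, paraConj_fromCols, fromCols_mul_fromRows, paraConj_smul, Matrix.smul_mul,
      Matrix.mul_smul, smul_smul, hb, one_smul, ← hM, add_sub_cancel]
  have hRreg : ∀ s : ℂ, 0 < s.re → ∀ i j, RegularAt s (R i j) := by
    rintro s hs i (j | j)
    · exact fun h0 => (h1.1 s ⟨i, j, h0⟩).not_gt hs
    · exact hbM s hs i j
  obtain ⟨c, hc1, hc2⟩ := exists_stabilizing_allpass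
    (fromCols (1 - paraConj R * R) (-paraConj R))
  have hU := dilation_mul_paraConj hc1 hR
  have hUreg : ∀ s : ℂ, 0 < s.re → ∀ i j, RegularAt s (dilation c R i j) := by
    rintro s hs (i | i) (j | j)
    · exact hRreg s hs i j
    · exact regularAt_zero
    · exact hc2 s hs i (Sum.inl j)
    · have h := hc2 s hs i (Sum.inr j)
      rw [Matrix.smul_apply, fromCols_apply_inr, neg_apply, smul_neg] at h
      exact h
  -- Outputs are grouped as `û` and the rest, inputs as `y` and the rest.
  let e₁ : Fin n ⊕ Fin (ny + n) ≃ Fin n ⊕ (Fin ny ⊕ Fin n) :=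
    (Equiv.refl _).sumCongr finSumFinEquiv.symm
  let e₂ : Fin ny ⊕ Fin (n + n) ≃ (Fin ny ⊕ Fin n) ⊕ Fin n :=
    ((Equiv.refl _).sumCongr finSumFinEquiv.symm).trans (Equiv.sumAssoc _ _ _).symm
  refine ⟨n + n, ny + n, (dilation c R).submatrix e₁ e₂,
    admissible_of_paraunitary (by omega) ?_ fun s hs i j => hUreg s hs _ _, ?_⟩
  · have h : paraConj ((dilation c R).submatrix e₁ e₂) =
        (paraConj (dilation c R)).submatrix e₂ e₁ := rfl
    rw [h, submatrix_mul_equiv, hU, submatrix_one_equiv]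
  · ext i j : 2
    rfl

/-! ### Conditions on the normal ranks -/

theorem value_intCast (s : ℂ) (k : ℤ) : value s (k : RatFunc ℂ) = k := by
  rw [← map_intCast (RatFunc.C (K := ℂ)), value, RatFunc.eval_C]
  simp

theorem regularAt_intCast (s : ℂ) (k : ℤ) : RegularAt s (k : RatFunc ℂ) := by
  rw [← map_intCast (RatFunc.C (K := ℂ))]
  exact regularAt_C _

theorem regularAt_prod_and_value {ι : Type*} (t : Finset ι) {F : ι → RatFunc ℂ} {s : ℂ}
    (h : ∀ i, RegularAt s (F i)) :
    RegularAt s (∏ i ∈ t, F i) ∧ value s (∏ i ∈ t, F i) = ∏ i ∈ t, value s (F i) := by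
  classical
  induction t using Finset.induction_on with
  | empty => exact ⟨by simpa using regularAt_one, by simp [value]⟩
  | insert a t ha ih =>
    rw [Finset.prod_insert ha, Finset.prod_insert ha]
    exact ⟨(h a).mul ih.1, by rw [value_mul (h a) ih.1, ih.2]⟩

theorem value_det {p : Type*} [Fintype p] [DecidableEq p] {X : RatMat p p} {s : ℂ}
    (h : ∀ i j, RegularAt s (X i j)) : value s X.det = (valAt X s).det := by
  have hp := fun σ : Equiv.Perm p =>
    regularAt_prod_and_value Finset.univ (F := fun i => X (σ i) i) fun i => h _ _
  rw [det_apply', det_apply', value_sum _ fun σ => (regularAt_intCast _ _).mul (hp σ).1]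
  refine Finset.sum_congr rfl fun σ _ => ?_
  rw [value_mul (regularAt_intCast _ _) (hp σ).1, (hp σ).2, value_intCast]
  rfl

theorem constNormalRankOnAxis_of_isUnit {k : ℕ} {X : RatMat (Fin k) (Fin k)}
    (hreg : ∀ (ω : ℝ) i j, RegularAt (Complex.I * ω) (X i j))
    (h : ∀ ω, IsUnit (onAxis X ω)) : ConstNormalRankOnAxis X := by
  refine ⟨k, ⟨⟨.refl _, .refl _, fun h0 => ?_⟩, fun l hl f => ?_⟩, fun ω => ?_⟩
  · have hX : X.det = 0 := h0
    have h1 := ((isUnit_iff_isUnit_det _).1 (h 0)).ne_zero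
    rw [onAxis, ← value_det (hreg 0), hX] at h1
    exact h1 (RatFunc.eval_zero _ _)
  · have := Fintype.card_le_of_embedding f
    simp at this
    omega
  · rw [rank_of_isUnit _ (h ω), Fintype.card_fin]

theorem condH3_of_posDef {n ny : ℕ} {H11 : RatMat (Fin n) (Fin ny)}
    (hreg : ∀ (ω : ℝ) i j, RegularAt (Complex.I * ω) (H11 i j))
    (hc : ∀ ω : ℝ, (1 - onAxis H11 ω * (onAxis H11 ω)ᴴ).PosDef) : CondH3 H11 := by
  constructor
  · refine constNormalRankOnAxis_of_isUnit (fun ω => regularAt_one_sub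
      (regularAt_mul (hreg ω) (regularAt_paraConj (hreg ω)))) fun ω => ?_
    rw [onAxis_one_sub_mul_paraConj (hreg ω)]
    exact (hc ω).isUnit
  · refine constNormalRankOnAxis_of_isUnit (fun ω => regularAt_one_sub
      (regularAt_mul (regularAt_paraConj (hreg ω)) (hreg ω))) fun ω => ?_
    rw [onAxis_one_sub_paraConj_mul (hreg ω), isUnit_iff_isUnit_det, ← det_one_sub_mul_comm,
      ← isUnit_iff_isUnit_det]
    exact (hc ω).isUnit

/-! ### The channel and the error spectrum -/

namespace Channel

variable {n nw ny nd m : ℕ} (S : Channel n nw ny nd m)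

/-- The channel is lossless: with `Φ = (sI - A)⁻¹` the cross terms in `G G^H` cancel since
`B B^† = (sI - A) + (sI - A)^H` and `B D^† = -C^†`. -/
theorem G_mul_paraConj : S.G * paraConj S.G = 1 := by
  set P : RatMat (Fin m) (Fin m) := (RatFunc.X : RatFunc ℂ) • 1 - const S.A with hP
  have hdet : IsUnit P.det := by
    have h : P = (S.A.charmatrix).map (algebraMap ℂ[X] (RatFunc ℂ)) := by
      ext i j : 2
      by_cases hij : i = j
      · subst hij
        simp [hP, const, RatFunc.algebraMap_C]
      · simp [hP, const, hij, RatFunc.algebraMap_C]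
    have hd : P.det = algebraMap ℂ[X] (RatFunc ℂ) S.A.charpoly := by
      rw [h, Matrix.charpoly, RingHom.map_det]
      rfl
    rw [hd]
    exact (RatFunc.algebraMap_ne_zero S.A.charpoly_monic.ne_zero).isUnit
  have hPσ : paraConj P = -((RatFunc.X : RatFunc ℂ) • 1) - const S.Aᴴ := by
    rw [hP, paraConj_sub, paraConj_smul, paraConj_one, ratParaConj_X, paraConj_const, neg_smul]
  have hl : P⁻¹ * P = 1 := nonsing_inv_mul _ hdet
  have hl' : paraConj P * paraConj P⁻¹ = 1 := by rw [← paraConj_mul, hl, paraConj_one]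
  have hBB : const S.B * const S.Bᴴ = P + paraConj P := by
    rw [hPσ, hP, ← const_mul, eq_neg_of_add_eq_zero_right S.lyapunov, const_neg, const_add]
    abel
  have hBD : const S.B * const S.Dᴴ = -const S.Cᴴ := by
    rw [← const_mul, S.coupling, Matrix.neg_mul, Matrix.mul_assoc, S.unitary_right,
      Matrix.mul_one, const_neg]
  have hDB : const S.D * const S.Bᴴ = -const S.C := by
    rw [← const_mul, S.coupling, conjTranspose_neg, conjTranspose_mul, conjTranspose_conjTranspose,
      Matrix.mul_neg, ← Matrix.mul_assoc, S.unitary_right, Matrix.one_mul, const_neg]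
  have hDD : const S.D * const S.Dᴴ = 1 := by rw [← const_mul, S.unitary_right, const_one]
  have hG : S.G = const S.D + const S.C * P⁻¹ * const S.B := rfl
  have h1 : P⁻¹ * (P + paraConj P) * paraConj P⁻¹ = paraConj P⁻¹ + P⁻¹ := by
    rw [Matrix.mul_add, hl, Matrix.add_mul, Matrix.one_mul, Matrix.mul_assoc, hl', Matrix.mul_one]
  have h2 : const S.C * P⁻¹ * const S.B * (const S.Bᴴ * (paraConj P⁻¹ * const S.Cᴴ)) =
      const S.C * (paraConj P⁻¹ + P⁻¹) * const S.Cᴴ := by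
    rw [← h1, ← hBB]
    simp only [Matrix.mul_assoc]
  rw [hG, paraConj_add, paraConj_mul, paraConj_mul, paraConj_const, paraConj_const, paraConj_const,
    Matrix.mul_add, Matrix.add_mul, Matrix.add_mul, hDD, h2, ← Matrix.mul_assoc (const S.D), hDB,
    Matrix.mul_assoc _ (const S.B), hBD]
  simp only [Matrix.mul_add, Matrix.add_mul, Matrix.neg_mul, Matrix.mul_neg, Matrix.mul_assoc]
  abel

theorem G11_mul_add_G12_mul :
    S.G11 * paraConj S.G11 + S.G12 * paraConj S.G12 = 1 := by
  have h := S.G_mul_paraConj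
  rw [← fromBlocks_toBlocks S.G, paraConj_fromBlocks, fromBlocks_multiply, ← fromBlocks_one] at h
  exact (fromBlocks_inj.1 h).1

/-- The vacuum noise `H₁₂ z` enters the error spectrum as `H₁₂ H₁₂^H = I - H₁₁ H₁₁^H` only. -/
theorem errorPSD_eq_psdOfBlock {nz nzh : ℕ} {H : RatMat (Fin n ⊕ Fin nzh) (Fin ny ⊕ Fin nz)}
    (hH : H * paraConj H = 1) : S.errorPSD H = S.psdOfBlock H.toBlocks₁₁ := by
  have h12 : H.toBlocks₁₂ * paraConj H.toBlocks₁₂ =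
      1 - H.toBlocks₁₁ * paraConj H.toBlocks₁₁ := by
    rw [← fromBlocks_toBlocks H, paraConj_fromBlocks, fromBlocks_multiply, ← fromBlocks_one] at hH
    exact eq_sub_of_add_eq' (fromBlocks_inj.1 hH).1
  have hG : S.G12 * (paraConj S.G12 * paraConj H.toBlocks₁₁) =
      paraConj H.toBlocks₁₁ - S.G11 * (paraConj S.G11 * paraConj H.toBlocks₁₁) := by
    rw [← Matrix.mul_assoc, ← Matrix.mul_assoc, eq_sub_iff_add_eq', ← Matrix.add_mul,
      G11_mul_add_G12_mul, Matrix.one_mul]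
  have hspec : const (S.inputSpectrum nz) = fromBlocks (fromBlocks (1 + const S.sigmaUᵀ) 0 0
      (1 + const S.sigmaWᵀ)) 0 0 1 := by
    rw [inputSpectrum, const_fromBlocks, const_fromBlocks]
    simp only [const_add, const_one, const_zero]
  have hU : const (S.sigmaUᵀ + (2 : ℂ) • 1) = const S.sigmaUᵀ + (1 + 1) := by
    rw [two_smul, const_add, const_add, const_one]
  rw [errorPSD, errorTransfer, hspec, paraConj_fromCols, paraConj_fromCols, psdOfBlock, Phi, hU,
    const_add, const_one, Psi]
  generalize H.toBlocks₁₁ = K at *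
  generalize H.toBlocks₁₂ = L at *
  simp only [fromCols_mul_fromBlocks, fromCols_mul_fromRows, Matrix.mul_zero, add_zero, zero_add,
    Matrix.mul_one, Matrix.one_mul, h12, paraConj_sub, paraConj_one, paraConj_mul, Matrix.mul_add,
    Matrix.add_mul, Matrix.mul_sub, Matrix.sub_mul, Matrix.mul_neg, Matrix.neg_mul,
    Matrix.mul_assoc, hG]
  abel

theorem exists_extension_of_mem {γ : ℝ} {H11 : RatMat (Fin n) (Fin ny)}
    (h : H11 ∈ S.contractiveSet γ) :
    ∃ (nz nzh : ℕ) (H : RatMat (Fin n ⊕ Fin nzh) (Fin ny ⊕ Fin nz)),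
      Admissible H ∧ H.toBlocks₁₁ = H11 ∧ BoundedOnAxis (S.errorPSD H) γ := by
  obtain ⟨-, h1, hb, hc, -⟩ := h
  obtain ⟨nz, nzh, H, hH, rfl⟩ := exists_admissible_extension h1 hc
  exact ⟨nz, nzh, H, hH, rfl, by rwa [S.errorPSD_eq_psdOfBlock hH.paraunitary_right]⟩

theorem gammaConstructed_eq : S.gammaConstructed = S.gammaContractive := by
  refine congrArg sInf (Set.ext fun γ => and_congr_right fun hγ => ⟨?_, ?_⟩)
  · rintro ⟨nz, nzh, H, hH, ⟨δ, -, hp, h1, -, hc⟩, hb⟩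
    rw [S.errorPSD_eq_psdOfBlock hH.paraunitary_right] at hb
    exact ⟨_, hp, h1, hb, hc⟩
  · rintro ⟨H11, h⟩
    obtain ⟨nz, nzh, H, hH, rfl, hb⟩ := S.exists_extension_of_mem h
    exact ⟨nz, nzh, H, hH, ⟨γ, hγ, h⟩, hb⟩

end Channel

end CoherentEq

end

theorem theorem1 {n nw ny nd m : ℕ} (S : CoherentEq.Channel n nw ny nd m) (γ : ℝ) (hγ : 0 < γ)
    (hne : (S.contractiveSet γ).Nonempty) :
    (∀ H11 ∈ S.contractiveSet γ,
      (CoherentEq.CondH1 H11 ∧ CoherentEq.CondH2 H11 ∧ CoherentEq.CondH3 H11) ∧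
      ∃ (nz nzh : ℕ) (H : CoherentEq.RatMat (Fin n ⊕ Fin nzh) (Fin ny ⊕ Fin nz)),
        CoherentEq.Admissible H ∧ H.toBlocks₁₁ = H11 ∧
          CoherentEq.BoundedOnAxis (S.errorPSD H) γ) ∧
    S.gammaConstructed = S.gammaContractive ∧
    S.gammaOpt ≤ S.gammaContractive := by
  refine ⟨fun H11 h => ⟨?_, S.exists_extension_of_mem h⟩, S.gammaConstructed_eq, ?_⟩
  · obtain ⟨-, h1, -, hc, -⟩ := h
    exact ⟨h1, fun ω => (hc ω).posSemidef, CoherentEq.condH3_of_posDef h1.regularAt_axis hc⟩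
  · refine csInf_le_csInf ⟨0, fun β hβ => hβ.1.le⟩ ⟨γ, hγ, hne⟩ ?_
    rintro β ⟨hβ, H11, h⟩
    obtain ⟨nz, nzh, H, hH, -, hb⟩ := S.exists_extension_of_mem h
    exact ⟨hβ, nz, nzh, H, hH, hb⟩
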